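/- All Boolean algebras are with $0$ and $1$, not necessarily distinct. For a topological space $X$, $RC(X)$ denotes the Boolean algebra of regular closed subsets of $X$ (sets $F$ with $F=\mathrm{cl}(\mathrm{int}\,F)$), with $F+G=F\cup G$, $F\cdot G=\mathrm{cl}(\mathrm{int}(F\cap G))$, $F^*=\mathrm{cl}(X\setminus F)$; for $F,G\in RC(X)$ write $F\,C_X\,G$ iff $F\cap G\neq\emptyset$, and for $x\in X$ put $\sigma_x=\{F\in RC(X): x\in F\}$. A *grill* of a Boolean algebra $B$ is a non-empty set $\Gamma\subseteq B$ with $0\notin\Gamma$, such that $a\in\Gamma$, $a\le b$ imply $b\in\Gamma$, and $a+b\in\Gamma$ implies $a\in\Gamma$ or $b\in\Gamma$. If $C$ is a contact relation on $B$ (that is, $aCb$ implies $a,b\ne 0$; $C$ is symmetric; $aCa$ for all $a\neq 0$; and $aC(b+c)$ iff $aCb$ or $aCc$), a *clan* of $(B,C)$ is a grill any two elements of which are $C$-related. A space $X$ is *semiregular* if $RC(X)$ is a closed base of $X$. A semiregular $T_0$-space $X$ is *C-semiregular* (resp. *extremally connected*) if every clan of $(RC(X),C_X)$ (resp. every grill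 of $RC(X)$) equals $\sigma_x$ for some $x\in X$. A *C-semiregular extension* of a space $Y$ is a pair $(X,f)$ where $X$ is a C-semiregular space and $f:Y\to X$ is a dense embedding. Two such extensions $(X_1,f_1)$, $(X_2,f_2)$ are *equivalent* if there is a homeomorphism $\varphi:X_1\to X_2$ with $\varphi\circ f_1=f_2$. Let $CSR(Y)$ be the class of all C-semiregular extensions of $Y$ up to equivalence. Put $[(X_1,f_1)]\le[(X_2,f_2)]$ if there is a continuous map $f:X_2\to X_1$ with $f\circ f_2=f_1$ (the projective order), and $[(X_1,f_1)]\le_{in}[(X_2,f_2)]$ if there is a homeomorphic embedding $f:X_1\to X_2$ with $f\circ f_1=f_2$ (the injective order). For a complete Boolean algebra $B$, let $D^a_c(B)$ be the set of all clans of $(B,\rho_l)$, where $a\,\rho_l\,b$ iff $a\ne0$ and $b\neq 0$ (that is, the set of all grills of $B$), with the topology having the sets $\{\Gamma: a\in\Gamma\}$, $a\in B$, as a closed base. **Corollary.** Let $Y$ be an extremally disconnected compact Hausdorff space and $B=RC(Y)$. Then $\le$ and $\le_{in}$ are (partial) orders on $CSR(Y)$, and $(CSR(Y),\le)$ and $(CSR(Y),\le_{in})$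 have largest and smallest elements. The largest (resp. smallest) element of $(CSR(Y),\le)$ coincides with the smallest (resp. largest) element of $(CSR(Y),\le_{in})$. If $[(\gamma Y,\gamma_Y)]$ is the largest element of $(CSR(Y),\le_{in})$, then $\gamma Y$ is an extremally connected space; in fact, $\gamma Y=D^a_c(B)$ with $\gamma_Y(y)=\{F\in B: y\in F\}$, up to a homeomorphism. Moreover, if $(cY,c)$ is a C-semiregular extension of $Y$ and $cY$ is extremally connected, then $(cY,c)$ and $(\gamma Y,\gamma_Y)$ are equivalent. -/

import Mathlib

universe u

open Topology TopologicalSpace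

namespace RegionSpace

/-! ## Contact relations, grills and clans on a Boolean algebra -/

/-- A contact relation on a Boolean algebra `B`. -/
structure ContactRel (B : Type u) [BooleanAlgebra B] where
  rel : B → B → Prop
  ne_bot : ∀ a b, rel a b → a ≠ ⊥ ∧ b ≠ ⊥
  sup_right : ∀ a b c, rel a (b ⊔ c) ↔ rel a b ∨ rel a c
  sup_left : ∀ a b c, rel (a ⊔ b) c ↔ rel a c ∨ rel b c
  refl : ∀ a, a ≠ ⊥ → rel a a
  symm : ∀ a b, rel a b → rel b a

/-- The largest contact relation `ρ_l` on `B`: `a ρ_l b` iff `a ≠ 0` and `b ≠ 0`. -/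
def ContactRel.largest (B : Type u) [BooleanAlgebra B] : ContactRel B where
  rel a b := a ≠ ⊥ ∧ b ≠ ⊥
  ne_bot _ _ h := h
  sup_right a b c := by
    have := @sup_eq_bot_iff B _ _ b c
    tauto
  sup_left a b c := by
    have := @sup_eq_bot_iff B _ _ a b
    tauto
  refl _ h := ⟨h, h⟩
  symm _ _ h := ⟨h.2, h.1⟩

/-- A grill of a Boolean algebra. -/
structure IsGrill {B : Type u} [BooleanAlgebra B] (Γ : Set B) : Prop where
  nonempty : Γ.Nonempty
  bot_notMem : ⊥ ∉ Γ
  mem_of_le : ∀ a b, a ∈ Γ → a ≤ b → b ∈ Γ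
  mem_or_mem : ∀ a b, a ⊔ b ∈ Γ → a ∈ Γ ∨ b ∈ Γ

/-- A clan of the contact algebra `(B, C)`: a grill any two elements of which are in contact. -/
structure IsClan {B : Type u} [BooleanAlgebra B] (C : ContactRel B) (Γ : Set B) : Prop
    extends IsGrill Γ where
  contact : ∀ a b, a ∈ Γ → b ∈ Γ → C.rel a b

/-- The set of all clans of `(B, C)`. -/
def Clans {B : Type u} [BooleanAlgebra B] (C : ContactRel B) : Type u :=
  {Γ : Set B // IsClan C Γ}

/-- The topology on the set of clans of `(B, C)` which has the sets `{Γ | a ∈ Γ}`, `a ∈ B`, as a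
closed base.  (These sets are closed under finite unions, so declaring their complements to be
a subbase of open sets gives this topology.) -/
instance {B : Type u} [BooleanAlgebra B] (C : ContactRel B) : TopologicalSpace (Clans C) :=
  generateFrom {U | ∃ a : B, U = {Γ : Clans C | a ∈ Γ.1}ᶜ}

/-- The space `D^a_c(B)`: the underlying space of the canonical Stone 2-space of `B`, that is, the
space of all clans of the contact algebra `(B, ρ_l)`. -/
abbrev Dac (B : Type u) [BooleanAlgebra B] : Type u := Clans (ContactRel.largest B)

/-! ## The standard contact algebra of a topological space -/

/-- The regular closed subsets of `X`. -/
def RC (X : Type u) [TopologicalSpace X] : Type u :=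
  {F : Set X // F = closure (interior F)}

section RC

variable {X : Type u} [TopologicalSpace X]

theorem RC.isClosed (F : RC X) : IsClosed F.1 := by
  rw [F.2]; exact isClosed_closure

/-- The closure of the interior of any set is regular closed. -/
def RC.ofSet (A : Set X) : RC X :=
  ⟨closure (interior A), by
    apply subset_antisymm
    · exact closure_mono (interior_maximal subset_closure isOpen_interior)
    · exact closure_minimal interior_subset isClosed_closure⟩

theorem RC.ofSet_subset {A F : Set X} (h : A ⊆ F) (hF : IsClosed F) : (RC.ofSet A).1 ⊆ F :=
  closure_minimal (interior_subset.trans h) hF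

theorem RC.subset_ofSet {F : RC X} {A : Set X} (h : F.1 ⊆ A) : F.1 ⊆ (RC.ofSet A).1 := by
  rw [F.2]; exact closure_mono (interior_mono h)

/-- The Boolean algebra of regular closed sets, with `F + G = F ∪ G`, `F* = cl (X \ F)`,
`F . G = cl (int (F ∩ G))`, `0 = ∅`, `1 = X`; its order is inclusion. -/
instance : BooleanAlgebra (RC X) where
  le F G := F.1 ⊆ G.1
  le_refl _ := subset_rfl
  le_trans _ _ _ h h' := h.trans h'
  le_antisymm _ _ h h' := Subtype.ext (subset_antisymm h h')
  sup F G := ⟨F.1 ∪ G.1, by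
    apply subset_antisymm
    · apply Set.union_subset
      · exact RC.subset_ofSet Set.subset_union_left
      · exact RC.subset_ofSet Set.subset_union_right
    · exact closure_minimal interior_subset (F.isClosed.union G.isClosed)⟩
  le_sup_left _ _ := Set.subset_union_left
  le_sup_right _ _ := Set.subset_union_right
  sup_le _ _ _ h h' := Set.union_subset h h'
  inf F G := RC.ofSet (F.1 ∩ G.1)
  inf_le_left F _ := RC.ofSet_subset Set.inter_subset_left F.isClosed
  inf_le_right _ G := RC.ofSet_subset Set.inter_subset_right G.isClosed
  le_inf _ _ _ h h' := RC.subset_ofSet (Set.subset_inter h h')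
  le_sup_inf F G H := by
    change closure (interior ((F.1 ∪ G.1) ∩ (F.1 ∪ H.1))) ⊆ F.1 ∪ closure (interior (G.1 ∩ H.1))
    refine closure_minimal ?_ (F.isClosed.union isClosed_closure)
    rw [← Set.union_inter_distrib_left]
    intro x hx
    by_cases hF : x ∈ F.1
    · exact Or.inl hF
    · refine Or.inr (subset_closure ?_)
      refine mem_interior.2 ⟨interior (F.1 ∪ G.1 ∩ H.1) ∩ F.1ᶜ, ?_,
        isOpen_interior.inter F.isClosed.isOpen_compl, hx, hF⟩
      rintro y ⟨hy, hyF⟩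
      exact (interior_subset hy).resolve_left hyF
  top := ⟨Set.univ, by simp⟩
  bot := ⟨∅, by simp⟩
  le_top _ := Set.subset_univ _
  bot_le _ := Set.empty_subset _
  compl F := ⟨closure (F.1ᶜ), by rw [F.isClosed.isOpen_compl.interior_eq.symm]; exact
    (RC.ofSet F.1ᶜ).2⟩
  inf_compl_le_bot F := by
    change closure (interior (F.1 ∩ closure (F.1ᶜ))) ⊆ ∅
    rw [interior_inter, closure_compl, Set.subset_empty_iff, closure_empty_iff,
      Set.eq_empty_iff_forall_notMem]
    rintro x ⟨hx, hx'⟩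
    exact interior_subset hx' hx
  top_le_sup_compl F := by
    intro x _
    by_cases hF : x ∈ F.1
    · exact Or.inl hF
    · exact Or.inr (subset_closure hF)

/-- The contact relation `C_X` of the standard contact algebra `(RC(X), C_X)`:
`F C_X G` iff `F ∩ G` is nonempty. -/
def standardContact (X : Type u) [TopologicalSpace X] : ContactRel (RC X) where
  rel F G := (F.1 ∩ G.1).Nonempty
  ne_bot := by
    rintro F G ⟨x, hF, hG⟩
    exact ⟨by rintro rfl; exact hF, by rintro rfl; exact hG⟩
  sup_right F G H := by
    change (F.1 ∩ (G.1 ∪ H.1)).Nonempty ↔ _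
    rw [Set.inter_union_distrib_left, Set.union_nonempty]
  sup_left F G H := by
    change ((F.1 ∪ G.1) ∩ H.1).Nonempty ↔ _
    rw [Set.union_inter_distrib_right, Set.union_nonempty]
  refl F hF := by
    rw [Set.inter_self]
    by_contra h
    exact hF (Subtype.ext (Set.not_nonempty_iff_eq_empty.1 h))
  symm F G h := by rwa [Set.inter_comm]

/-- `σ_x`, the set of all regular closed sets that contain `x`. -/
def sigma (x : X) : Set (RC X) := {F | x ∈ F.1}

end RC

/-! ## C-semiregular and extremally connected spaces -/

/-- `X` is semiregular: `RC(X)` is a closed base for `X`, i.e. the complements of the regular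
closed sets form an open base. -/
def Semiregular (X : Type u) [TopologicalSpace X] : Prop :=
  IsTopologicalBasis {U : Set X | ∃ F : RC X, U = F.1ᶜ}

/-- A C-semiregular space: a semiregular `T₀`-space in which every clan of `(RC(X), C_X)` is of
the form `σ_x`. -/
structure CSemiregular (X : Type u) [TopologicalSpace X] : Prop where
  t0 : T0Space X
  semiregular : Semiregular X
  exists_point : ∀ Γ : Set (RC X), IsClan (standardContact X) Γ → ∃ x : X, Γ = sigma x

/-- An extremally connected space: a semiregular `T₀`-space in which every grill of `RC(X)` is of
the form `σ_x`. -/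
structure ExtremallyConnected (X : Type u) [TopologicalSpace X] : Prop where
  t0 : T0Space X
  semiregular : Semiregular X
  exists_point : ∀ Γ : Set (RC X), IsGrill Γ → ∃ x : X, Γ = sigma x

/-! ## C-semiregular extensions and their orders -/

/-- A C-semiregular extension of `Y`: a C-semiregular space with a dense embedding of `Y`. -/
structure CSRExtension (Y : Type u) [TopologicalSpace Y] : Type (u + 1) where
  space : Type u
  [top : TopologicalSpace space]
  emb : Y → space
  isDenseEmbedding : IsDenseEmbedding emb
  csemiregular : CSemiregular space

attribute [instance] CSRExtension.top

namespace CSRExtension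

variable {Y : Type u} [TopologicalSpace Y]

/-- Equivalence (isomorphism) of extensions of `Y`. -/
def Equivalent (e₁ e₂ : CSRExtension Y) : Prop :=
  ∃ φ : e₁.space ≃ₜ e₂.space, φ ∘ e₁.emb = e₂.emb

/-- `e₂` is projectively larger than `e₁`. -/
def ProjLE (e₁ e₂ : CSRExtension Y) : Prop :=
  ∃ f : e₂.space → e₁.space, Continuous f ∧ f ∘ e₂.emb = e₁.emb

/-- `e₂` is injectively larger than `e₁`. -/
def InjLE (e₁ e₂ : CSRExtension Y) : Prop :=
  ∃ f : e₁.space → e₂.space, IsEmbedding f ∧ f ∘ e₁.emb = e₂.emb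

theorem Equivalent.symm {e₁ e₂ : CSRExtension Y} : Equivalent e₁ e₂ → Equivalent e₂ e₁ := by
  rintro ⟨φ, h⟩
  exact ⟨φ.symm, by rw [← h]; ext y; simp⟩

instance setoid (Y : Type u) [TopologicalSpace Y] : Setoid (CSRExtension Y) where
  r := Equivalent
  iseqv :=
    { refl := fun e => ⟨Homeomorph.refl _, rfl⟩
      symm := Equivalent.symm
      trans := by
        rintro e₁ e₂ e₃ ⟨φ, h⟩ ⟨ψ, k⟩
        exact ⟨φ.trans ψ, by rw [← k, ← h]; rfl⟩ }

theorem ProjLE.congr {a b a' b' : CSRExtension Y} (h : Equivalent a a') (k : Equivalent b b') :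
    ProjLE a b → ProjLE a' b' := by
  obtain ⟨φ, h⟩ := h
  obtain ⟨ψ, k⟩ := k.symm
  rintro ⟨f, hf, e⟩
  exact ⟨φ ∘ f ∘ ψ, φ.continuous.comp (hf.comp ψ.continuous), by rw [← h, ← e, ← k]; rfl⟩

theorem InjLE.congr {a b a' b' : CSRExtension Y} (h : Equivalent a a') (k : Equivalent b b') :
    InjLE a b → InjLE a' b' := by
  obtain ⟨φ, h⟩ := h.symm
  obtain ⟨ψ, k⟩ := k
  rintro ⟨f, hf, e⟩
  exact ⟨ψ ∘ f ∘ φ, ψ.isEmbedding.comp (hf.comp φ.isEmbedding), by rw [← k, ← e, ← h]; rfl⟩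

end CSRExtension

/-- The class of all C-semiregular extensions of `Y` up to equivalence. -/
abbrev CSR (Y : Type u) [TopologicalSpace Y] : Type (u + 1) := Quotient (CSRExtension.setoid Y)

namespace CSR

variable {Y : Type u} [TopologicalSpace Y]

/-- The projective order `≤` on equivalence classes. -/
def ProjLE : CSR Y → CSR Y → Prop :=
  Quotient.lift₂ CSRExtension.ProjLE fun _ _ _ _ h k =>
    propext ⟨CSRExtension.ProjLE.congr h k,
      CSRExtension.ProjLE.congr (CSRExtension.Equivalent.symm h) (CSRExtension.Equivalent.symm k)⟩

/-- The injective order `≤_in` on equivalence classes. -/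
def InjLE : CSR Y → CSR Y → Prop :=
  Quotient.lift₂ CSRExtension.InjLE fun _ _ _ _ h k =>
    propext ⟨CSRExtension.InjLE.congr h k,
      CSRExtension.InjLE.congr (CSRExtension.Equivalent.symm h) (CSRExtension.Equivalent.symm k)⟩

end CSR

/-- `m` is the largest element with respect to the relation `r`. -/
def IsLargest {α : Type*} (r : α → α → Prop) (m : α) : Prop := ∀ a, r a m

/-- `m` is the smallest element with respect to the relation `r`. -/
def IsSmallest {α : Type*} (r : α → α → Prop) (m : α) : Prop := ∀ a, r m a

end RegionSpace

open RegionSpace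

/-!
Restricting regular closed sets along a dense embedding `f : Y → X` is an isomorphism
`RC X ≃o RC Y`, with inverse `G ↦ cl (f G)` (`RC.trace`).  Carrying the standard contact relation
of `X` across it attaches to every C-semiregular extension `e` of `Y` a contact relation
`e.contact` on `RC Y`: two sets are in contact when the closures of their images meet.  Such an
extension is determined by this relation: C-semiregularity says exactly that sending a point to the
set of regular closed sets through it is a homeomorphism onto the clan space
(`CSemiregular.homeomorph`), so the extension is the space of clans of `e.contact`
(`CSRExtension.homeomorph`).

A continuous map of extensions over `Y` can only enlarge the contact relation, and conversely an
inclusion of contact relations embeds the corresponding clan spaces.  Hence `InjLE` is inclusion of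
contact relations and `ProjLE` is its reverse (`CSRExtension.injLE_iff`,
`CSRExtension.projLE_iff`), which gives the partial orders and the exchange of extreme elements.

Every contact relation containing the standard one of `Y` gives an extension by its space of clans
(`CSRExtension.ofContact`).  The standard contact relation of `Y` itself yields the smallest
relation that occurs.  The relation `ρ_l` yields the largest one, because the set of all nonzero
elements is a grill.  Finally, an extension is extremally connected exactly when any two nonempty
regular closed sets meet, that is, when its contact relation is `ρ_l`.
-/

namespace RegionSpace

/-! ### Contact relations and spaces of clans -/

section Clans

variable {B B' : Type u} [BooleanAlgebra B] [BooleanAlgebra B']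

@[ext]
theorem ContactRel.ext {C D : ContactRel B} (h : ∀ a b, C.rel a b ↔ D.rel a b) : C = D := by
  cases C
  cases D
  congr
  ext a b
  exact h a b

/-- Contact relations are ordered by inclusion. -/
instance : PartialOrder (ContactRel B) where
  le C D := ∀ a b, C.rel a b → D.rel a b
  le_refl _ _ _ h := h
  le_trans _ _ _ h k a b r := k a b (h a b r)
  le_antisymm _ _ h k := ContactRel.ext fun a b => ⟨h a b, k a b⟩

theorem ContactRel.le_largest (C : ContactRel B) : C ≤ ContactRel.largest B :=
  fun a b h => C.ne_bot a b h

/-- The contact relation transported along an isomorphism of Boolean algebras. -/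
def ContactRel.map (φ : B ≃o B') (C : ContactRel B) : ContactRel B' where
  rel a b := C.rel (φ.symm a) (φ.symm b)
  ne_bot a b h := by simpa using C.ne_bot _ _ h
  sup_right a b c := by simp [C.sup_right]
  sup_left a b c := by simp [C.sup_left]
  refl a h := C.refl _ (by simpa using h)
  symm a b h := C.symm _ _ h

theorem IsGrill.top_mem {Γ : Set B} (h : IsGrill Γ) : ⊤ ∈ Γ :=
  let ⟨a, ha⟩ := h.nonempty
  h.mem_of_le a ⊤ ha le_top

theorem IsGrill.preimage (φ : B ≃o B') {Γ : Set B'} (h : IsGrill Γ) : IsGrill (φ ⁻¹' Γ) where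
  nonempty := ⟨⊤, by simpa using h.top_mem⟩
  bot_notMem := by simpa using h.bot_notMem
  mem_of_le a b ha hab := h.mem_of_le _ _ ha (φ.monotone hab)
  mem_or_mem a b hab := h.mem_or_mem _ _ (by simpa using hab)

theorem isGrill_ne_bot [Nontrivial B] : IsGrill {a : B | a ≠ ⊥} where
  nonempty := ⟨⊤, top_ne_bot⟩
  bot_notMem h := h rfl
  mem_of_le _ _ ha hab := ne_bot_of_le_ne_bot ha hab
  mem_or_mem a b h := by
    by_contra! hab
    simp only [Set.mem_ofPred_eq, not_not] at hab
    exact h (by rw [hab.1, hab.2, sup_bot_eq])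

theorem IsClan.mono {C D : ContactRel B} (h : C ≤ D) {Γ : Set B} (hΓ : IsClan C Γ) :
    IsClan D Γ :=
  { hΓ.toIsGrill with contact := fun a b ha hb => h a b (hΓ.contact a b ha hb) }

theorem isClan_largest_iff {Γ : Set B} : IsClan (ContactRel.largest B) Γ ↔ IsGrill Γ :=
  ⟨fun h => h.toIsGrill, fun h =>
    { h with
      contact := fun a b ha hb =>
        ⟨by rintro rfl; exact h.bot_notMem ha, by rintro rfl; exact h.bot_notMem hb⟩ }⟩

namespace Clans

variable {C D : ContactRel B}

/-- The closed set of all clans that contain `a`. -/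
def basicClosed (C : ContactRel B) (a : B) : Set (Clans C) := {Γ | a ∈ Γ.1}

theorem isClosed_basicClosed (a : B) : IsClosed (basicClosed C a) :=
  ⟨isOpen_generateFrom_of_mem ⟨a, rfl⟩⟩

theorem basicClosed_sup (a b : B) :
    basicClosed C (a ⊔ b) = basicClosed C a ∪ basicClosed C b := by
  ext Γ
  exact ⟨Γ.2.mem_or_mem a b, fun h => h.elim (fun h => Γ.2.mem_of_le _ _ h le_sup_left)
    fun h => Γ.2.mem_of_le _ _ h le_sup_right⟩

theorem isTopologicalBasis :
    IsTopologicalBasis {U | ∃ a : B, U = (basicClosed C a)ᶜ} where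
  exists_subset_inter := by
    rintro _ ⟨a, rfl⟩ _ ⟨b, rfl⟩ Γ hΓ
    refine ⟨_, ⟨a ⊔ b, rfl⟩, ?_, ?_⟩ <;> rw [basicClosed_sup, Set.compl_union]
    exact hΓ
  sUnion_eq := Set.eq_univ_of_forall fun Γ =>
    ⟨_, ⟨⊥, rfl⟩, Γ.2.bot_notMem⟩
  eq_generateFrom := rfl

/-- A map into a space of clans is inducing as soon as the preimages of the generating open sets
generate the topology of its source. -/
theorem isInducing {Z : Type*} [t : TopologicalSpace Z] {f : Z → Clans C}
    (h : t = generateFrom {U | ∃ a : B, U = {z | a ∈ (f z).1}ᶜ}) : IsInducing f := by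
  refine ⟨h.trans (Eq.trans ?_ induced_generateFrom_eq.symm)⟩
  congr 1
  ext U
  constructor
  · rintro ⟨a, rfl⟩
    exact ⟨_, ⟨a, rfl⟩, rfl⟩
  · rintro ⟨_, ⟨a, rfl⟩, rfl⟩
    exact ⟨a, rfl⟩

instance : T0Space (Clans C) := by
  refine ⟨fun Γ Δ h => Subtype.ext (Set.ext fun a => ?_)⟩
  have := h.mem_closed_iff (isClosed_basicClosed (C := C) a)
  exact this

/-- The inclusion of spaces of clans given by an inclusion of contact relations. -/
def inclusion (h : C ≤ D) (Γ : Clans C) : Clans D := ⟨Γ.1, Γ.2.mono h⟩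

theorem isEmbedding_inclusion (h : C ≤ D) : IsEmbedding (inclusion h) :=
  ⟨isInducing rfl, fun _ _ e => Subtype.ext (Subtype.ext_iff.1 e :)⟩

/-- An isomorphism of Boolean algebras induces a homeomorphism of spaces of clans. -/
def mapHomeomorph (φ : B ≃o B') (C : ContactRel B) : Clans C ≃ₜ Clans (C.map φ) where
  toFun Γ := ⟨φ.symm ⁻¹' Γ.1,
    { Γ.2.toIsGrill.preimage φ.symm with
      contact := fun _ _ ha hb => Γ.2.contact _ _ ha hb }⟩
  invFun Γ := ⟨φ ⁻¹' Γ.1,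
    { Γ.2.toIsGrill.preimage φ with
      contact := fun a b ha hb => by
        simpa [ContactRel.map] using Γ.2.contact _ _ ha hb }⟩
  left_inv Γ := Subtype.ext (by ext; simp)
  right_inv Γ := Subtype.ext (by ext; simp)
  continuous_toFun := continuous_generateFrom_iff.2 (by
    rintro _ ⟨a, rfl⟩
    exact (isClosed_basicClosed (C := C) (φ.symm a)).isOpen_compl)
  continuous_invFun := continuous_generateFrom_iff.2 (by
    rintro _ ⟨a, rfl⟩
    exact (isClosed_basicClosed (C := C.map φ) (φ a)).isOpen_compl)

end Clans

end Clans

/-! ### Regular closed sets under dense embeddings -/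

section Trace

variable {X Y : Type u} [TopologicalSpace X] [TopologicalSpace Y]

theorem closure_isRegularClosed {U : Set X} (hU : IsOpen U) :
    closure U = closure (interior (closure U)) := by
  have := (RC.ofSet U).2
  simpa only [RC.ofSet, hU.interior_eq] using this

theorem closure_image_preimage_of_isOpen {ι : Type*} {f : ι → X} (hf : DenseRange f) {U : Set X}
    (hU : IsOpen U) : closure (f '' (f ⁻¹' U)) = closure U :=
  subset_antisymm (closure_mono (Set.image_preimage_subset f U))
    (closure_minimal (hf.subset_closure_image_preimage_of_isOpen hU) isClosed_closure)

theorem preimage_isRegularClosed {f : Y → X} (hf : IsDenseEmbedding f) (F : RC X) :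
    f ⁻¹' F.1 = closure (interior (f ⁻¹' F.1)) := by
  have h : f ⁻¹' F.1 = closure (f ⁻¹' interior F.1) := by
    rw [hf.isInducing.closure_eq_preimage_closure_image,
      closure_image_preimage_of_isOpen hf.dense isOpen_interior, ← F.2]
  rw [h]
  exact closure_isRegularClosed (isOpen_interior.preimage hf.continuous)

theorem closure_image_isRegularClosed {f : Y → X} (hf : IsDenseEmbedding f) (G : RC Y) :
    closure (f '' G.1) = closure (interior (closure (f '' G.1))) := by
  obtain ⟨U, hU, e⟩ := hf.isInducing.isOpen_iff.1 (isOpen_interior (s := G.1))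
  have h : closure (f '' G.1) = closure U := by
    rw [G.2, closure_image_closure hf.continuous, ← e,
      closure_image_preimage_of_isOpen hf.dense hU]
  rw [h]
  exact closure_isRegularClosed hU

theorem closure_image_preimage {f : Y → X} (hf : IsDenseEmbedding f) (F : RC X) :
    closure (f '' (f ⁻¹' F.1)) = F.1 := by
  refine subset_antisymm (closure_minimal (Set.image_preimage_subset f F.1) F.isClosed) ?_
  conv_lhs => rw [F.2, ← closure_image_preimage_of_isOpen hf.dense isOpen_interior]
  exact closure_mono (Set.image_mono (Set.preimage_mono interior_subset))

/-- A dense embedding `f : Y → X` identifies the regular closed sets of `X` with those of `Y`, by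
`F ↦ f ⁻¹' F` and `G ↦ closure (f '' G)`. -/
def RC.trace {f : Y → X} (hf : IsDenseEmbedding f) : RC X ≃o RC Y where
  toFun F := ⟨f ⁻¹' F.1, preimage_isRegularClosed hf F⟩
  invFun G := ⟨closure (f '' G.1), closure_image_isRegularClosed hf G⟩
  left_inv F := Subtype.ext (closure_image_preimage hf F)
  right_inv G := Subtype.ext (by
    change f ⁻¹' closure (f '' G.1) = G.1
    rw [← hf.isInducing.closure_eq_preimage_closure_image, G.isClosed.closure_eq])
  map_rel_iff' {F G} := by
    refine ⟨fun h => ?_, fun h => Set.preimage_mono h⟩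
    have := closure_mono (Set.image_mono (f := f) h)
    change closure (f '' (f ⁻¹' F.1)) ⊆ closure (f '' (f ⁻¹' G.1)) at this
    rwa [closure_image_preimage hf, closure_image_preimage hf] at this

/-- `σ_x` is a clan. -/
theorem isClan_sigma (x : X) : IsClan (standardContact X) (sigma x) where
  nonempty := ⟨⊤, Set.mem_univ x⟩
  bot_notMem h := h
  mem_of_le _ _ ha hab := hab ha
  mem_or_mem _ _ h := h
  contact _ _ ha hb := ⟨x, ha, hb⟩

theorem Semiregular.eq_generateFrom (h : Semiregular X) :
    ‹TopologicalSpace X› = generateFrom {U | ∃ F : RC X, U = {x | F ∈ sigma x}ᶜ} :=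
  IsTopologicalBasis.eq_generateFrom h

/-- The canonical map of `X` into the space of clans of a contact relation on `RC X` that contains
the standard one. -/
def toClans {C : ContactRel (RC X)} (hC : standardContact X ≤ C) (x : X) : Clans C :=
  ⟨sigma x, (isClan_sigma x).mono hC⟩

theorem isEmbedding_toClans [T0Space X] (h : Semiregular X) {C : ContactRel (RC X)}
    (hC : standardContact X ≤ C) : IsEmbedding (toClans hC) :=
  (Clans.isInducing (f := toClans hC) h.eq_generateFrom).isEmbedding

theorem semiregular_of_regularSpace [RegularSpace X] : Semiregular X := by
  refine isTopologicalBasis_of_isOpen_of_nhds ?_ ?_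
  · rintro _ ⟨F, rfl⟩
    exact F.isClosed.isOpen_compl
  · intro x U hx hU
    obtain ⟨K, hK, hKc, hKU⟩ := exists_mem_nhds_isClosed_subset (hU.mem_nhds hx)
    refine ⟨_, ⟨RC.ofSet Kᶜ, rfl⟩, ?_, ?_⟩
    · change x ∉ closure (interior Kᶜ)
      rwa [hKc.isOpen_compl.interior_eq, closure_compl, Set.notMem_compl_iff,
        mem_interior_iff_mem_nhds]
    · refine Set.compl_subset_comm.1 ((Set.compl_subset_compl.2 hKU).trans ?_)
      change Kᶜ ⊆ closure (interior Kᶜ)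
      rw [hKc.isOpen_compl.interior_eq]
      exact subset_closure

/-- A C-semiregular space is the space of clans of its standard contact algebra. -/
noncomputable def CSemiregular.homeomorph (h : CSemiregular X) :
    X ≃ₜ Clans (standardContact X) :=
  haveI := h.t0
  (isEmbedding_toClans h.semiregular le_rfl).toHomeomorphOfSurjective fun Γ =>
    let ⟨x, hx⟩ := h.exists_point Γ.1 Γ.2
    ⟨x, Subtype.ext hx.symm⟩

theorem CSemiregular.homeomorph_apply (h : CSemiregular X) (x : X) :
    (h.homeomorph x).1 = sigma x :=
  rfl

end Trace

/-! ### The contact relation of an extension -/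

namespace CSRExtension

variable {Y : Type u} [TopologicalSpace Y]

/-- The contact relation on `RC Y` induced by an extension: `G` and `H` are in contact when the
closures of their images in the extension meet. -/
def contact (e : CSRExtension Y) : ContactRel (RC Y) :=
  (standardContact e.space).map (RC.trace e.isDenseEmbedding)

theorem contact_rel (e : CSRExtension Y) (G H : RC Y) :
    e.contact.rel G H ↔ (closure (e.emb '' G.1) ∩ closure (e.emb '' H.1)).Nonempty :=
  Iff.rfl

theorem standardContact_le_contact (e : CSRExtension Y) : standardContact Y ≤ e.contact := by
  rintro G H ⟨y, hG, hH⟩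
  exact ⟨e.emb y, subset_closure ⟨y, hG, rfl⟩, subset_closure ⟨y, hH, rfl⟩⟩

/-- An extension is the space of clans of its contact relation. -/
noncomputable def homeomorph (e : CSRExtension Y) : e.space ≃ₜ Clans e.contact :=
  e.csemiregular.homeomorph.trans (Clans.mapHomeomorph (RC.trace e.isDenseEmbedding) _)

theorem homeomorph_emb (e : CSRExtension Y) (y : Y) : (e.homeomorph (e.emb y)).1 = sigma y := by
  ext G
  change (RC.trace e.isDenseEmbedding).symm G ∈ (e.csemiregular.homeomorph (e.emb y)).1 ↔ _
  rw [CSemiregular.homeomorph_apply]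
  change e.emb y ∈ closure (e.emb '' G.1) ↔ y ∈ G.1
  rw [← Set.mem_preimage, ← e.isDenseEmbedding.isInducing.closure_eq_preimage_closure_image,
    G.isClosed.closure_eq]

/-- A continuous map over `Y` preserves contact, since it maps closures into closures. -/
theorem contact_le_of_continuous {e₁ e₂ : CSRExtension Y} {f : e₁.space → e₂.space}
    (hf : Continuous f) (h : f ∘ e₁.emb = e₂.emb) : e₁.contact ≤ e₂.contact := by
  rintro G H ⟨x, hG, hH⟩
  have key : ∀ K : RC Y, x ∈ closure (e₁.emb '' K.1) → f x ∈ closure (e₂.emb '' K.1) := by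
    intro K hK
    rw [← h, Set.image_comp]
    exact image_closure_subset_closure_image hf ⟨x, hK, rfl⟩
  exact ⟨f x, key G hG, key H hH⟩

theorem injLE_of_contact_le {e₁ e₂ : CSRExtension Y} (h : e₁.contact ≤ e₂.contact) :
    InjLE e₁ e₂ := by
  refine ⟨e₂.homeomorph.symm ∘ Clans.inclusion h ∘ e₁.homeomorph,
    e₂.homeomorph.symm.isEmbedding.comp
      ((Clans.isEmbedding_inclusion h).comp e₁.homeomorph.isEmbedding), ?_⟩
  ext y
  refine e₂.homeomorph.symm_apply_eq.2 (Subtype.ext ?_)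
  exact (e₁.homeomorph_emb y).trans (e₂.homeomorph_emb y).symm

theorem injLE_iff {e₁ e₂ : CSRExtension Y} : InjLE e₁ e₂ ↔ e₁.contact ≤ e₂.contact :=
  ⟨fun ⟨_, hf, h⟩ => contact_le_of_continuous hf.continuous h, injLE_of_contact_le⟩

theorem projLE_iff {e₁ e₂ : CSRExtension Y} : ProjLE e₁ e₂ ↔ e₂.contact ≤ e₁.contact :=
  ⟨fun ⟨_, hf, h⟩ => contact_le_of_continuous hf h, fun h =>
    let ⟨f, hf, k⟩ := injLE_of_contact_le h
    ⟨f, hf.continuous, k⟩⟩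

/-- An extension is equivalent to the space of clans of any relation equal to its contact
relation. -/
theorem exists_homeomorph_of_contact_eq (e : CSRExtension Y) {C : ContactRel (RC Y)}
    (h : e.contact = C) : ∃ φ : e.space ≃ₜ Clans C, ∀ y, (φ (e.emb y)).1 = sigma y := by
  subst h
  exact ⟨e.homeomorph, e.homeomorph_emb⟩

theorem equivalent_of_contact_eq {e₁ e₂ : CSRExtension Y} (h : e₁.contact = e₂.contact) :
    Equivalent e₁ e₂ := by
  obtain ⟨φ, hφ⟩ := e₁.exists_homeomorph_of_contact_eq h
  refine ⟨φ.trans e₂.homeomorph.symm, ?_⟩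
  ext y
  exact e₂.homeomorph.symm_apply_eq.2 (Subtype.ext ((hφ y).trans (e₂.homeomorph_emb y).symm))

end CSRExtension

/-! ### Spaces of clans as extensions -/

section OfContact

variable {Y : Type u} [TopologicalSpace Y] {C : ContactRel (RC Y)}

theorem closure_image_toClans (hC : standardContact Y ≤ C) (G : RC Y) :
    closure (toClans hC '' G.1) = Clans.basicClosed C G := by
  refine subset_antisymm (closure_minimal ?_ (Clans.isClosed_basicClosed G)) fun Γ hΓ => ?_
  · rintro _ ⟨y, hy, rfl⟩
    exact hy
  · refine Clans.isTopologicalBasis.mem_closure_iff.2 ?_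
    rintro _ ⟨H, rfl⟩ hH
    by_contra hne
    -- A basic open set missing the image of `G` is given by some `H` that contains `G`.
    refine hH (Γ.2.mem_of_le G H hΓ fun y hy => ?_)
    by_contra hyH
    exact hne ⟨toClans hC y, hyH, y, hy, rfl⟩

theorem isDenseEmbedding_toClans [T0Space Y] (hY : Semiregular Y) (hC : standardContact Y ≤ C) :
    IsDenseEmbedding (toClans hC) := by
  have he : IsEmbedding (toClans hC) := isEmbedding_toClans hY hC
  refine { he with dense := fun Γ => ?_ }
  have h := closure_image_toClans hC ⊤
  change closure (toClans hC '' Set.univ) = _ at h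
  rw [← Set.image_univ, h]
  exact Γ.2.top_mem

theorem cSemiregular_clans [T0Space Y] (hY : Semiregular Y) (hC : standardContact Y ≤ C) :
    CSemiregular (Clans C) := by
  have hd := isDenseEmbedding_toClans hY hC
  have hsymm : ∀ G : RC Y, ((RC.trace hd).symm G).1 = Clans.basicClosed C G :=
    closure_image_toClans hC
  refine ⟨inferInstance, ?_, fun Γ hΓ => ?_⟩
  · have hset : {U | ∃ F : RC (Clans C), U = F.1ᶜ} =
        {U | ∃ a : RC Y, U = (Clans.basicClosed C a)ᶜ} := by
      ext U
      constructor
      · rintro ⟨F, rfl⟩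
        exact ⟨RC.trace hd F, by rw [← hsymm, OrderIso.symm_apply_apply]⟩
      · rintro ⟨G, rfl⟩
        exact ⟨(RC.trace hd).symm G, by rw [hsymm]⟩
    rw [Semiregular, hset]
    exact Clans.isTopologicalBasis
  · -- The point representing a clan `Γ` is the clan of the traces of its members on `Y`.
    refine ⟨⟨(RC.trace hd).symm ⁻¹' Γ,
      { hΓ.toIsGrill.preimage (RC.trace hd).symm with
        contact := fun G H hG hH => ?_ }⟩, Set.ext fun F => ?_⟩
    · obtain ⟨Δ, hΔG, hΔH⟩ := hΓ.contact _ _ hG hH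
      rw [hsymm] at hΔG hΔH
      exact Δ.2.contact G H hΔG hΔH
    · obtain ⟨G, rfl⟩ := (RC.trace hd).symm.surjective F
      change _ ↔ _ ∈ ((RC.trace hd).symm G).1
      rw [hsymm]
      rfl

namespace CSRExtension

/-- The extension of a semiregular `T₀`-space `Y` by the clans of a contact relation on `RC Y` that
contains the standard one. -/
def ofContact [T0Space Y] (hY : Semiregular Y) (hC : standardContact Y ≤ C) : CSRExtension Y where
  space := Clans C
  emb := toClans hC
  isDenseEmbedding := isDenseEmbedding_toClans hY hC
  csemiregular := cSemiregular_clans hY hC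

theorem contact_ofContact_rel [T0Space Y] (hY : Semiregular Y) (hC : standardContact Y ≤ C)
    (G H : RC Y) :
    (ofContact hY hC).contact.rel G H ↔ ∃ Γ : Clans C, G ∈ Γ.1 ∧ H ∈ Γ.1 := by
  rw [contact_rel]
  change (closure (toClans hC '' G.1) ∩ closure (toClans hC '' H.1)).Nonempty ↔ _
  rw [closure_image_toClans, closure_image_toClans]
  rfl

theorem contact_ofContact_le [T0Space Y] (hY : Semiregular Y) (hC : standardContact Y ≤ C) :
    (ofContact hY hC).contact ≤ C := by
  intro G H h
  obtain ⟨Γ, hG, hH⟩ := (contact_ofContact_rel hY hC G H).1 h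
  exact Γ.2.contact G H hG hH

theorem contact_ofContact_largest [T0Space Y] (hY : Semiregular Y) :
    (ofContact hY (standardContact Y).le_largest).contact = ContactRel.largest (RC Y) := by
  refine le_antisymm (ContactRel.le_largest _) fun G H h => ?_
  have : Nontrivial (RC Y) := ⟨⟨G, ⊥, h.1⟩⟩
  exact (contact_ofContact_rel hY _ G H).2
    ⟨⟨{K | K ≠ ⊥}, isClan_largest_iff.2 isGrill_ne_bot⟩, h.1, h.2⟩

/-! ### Extremally connected extensions -/

theorem extremallyConnected_iff (e : CSRExtension Y) :
    ExtremallyConnected e.space ↔ e.contact = ContactRel.largest (RC Y) := by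
  constructor
  · refine fun h => le_antisymm (ContactRel.le_largest _) fun G H hGH => ?_
    have hne : ∀ K : RC Y, K ≠ ⊥ → (RC.trace e.isDenseEmbedding).symm K ≠ ⊥ := by simp
    have : Nontrivial (RC e.space) := ⟨⟨_, ⊥, hne G hGH.1⟩⟩
    -- The point representing the grill of all nonzero elements lies in both closures.
    obtain ⟨x, hx⟩ := h.exists_point _ (isGrill_ne_bot (B := RC e.space))
    exact ⟨x, hx.subset (hne G hGH.1), hx.subset (hne H hGH.2)⟩
  · refine fun h => ⟨e.csemiregular.t0, e.csemiregular.semiregular, fun Γ hΓ =>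
      e.csemiregular.exists_point Γ { hΓ with contact := fun F G hF hG => ?_ }⟩
    have hrel : e.contact.rel (RC.trace e.isDenseEmbedding F) (RC.trace e.isDenseEmbedding G) := by
      rw [h]
      constructor
      · rw [Ne, map_eq_bot_iff]
        rintro rfl
        exact hΓ.bot_notMem hF
      · rw [Ne, map_eq_bot_iff]
        rintro rfl
        exact hΓ.bot_notMem hG
    simpa [contact, ContactRel.map] using hrel

end CSRExtension

end OfContact

end RegionSpace

theorem corollary9p1 (Y : Type u) [TopologicalSpace Y] [CompactSpace Y] [T2Space Y]
    [ExtremallyDisconnected Y] :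
    -- both relations are orders on the equivalence classes
    IsPartialOrder (CSR Y) CSR.ProjLE ∧ IsPartialOrder (CSR Y) CSR.InjLE ∧
    -- largest and smallest elements exist in both orders, and are interchanged
    (∃ s l : CSR Y,
      IsSmallest CSR.InjLE s ∧ IsLargest CSR.ProjLE s ∧
      IsLargest CSR.InjLE l ∧ IsSmallest CSR.ProjLE l) ∧
    -- description of the largest element of the injective order
    (∀ γ : CSRExtension Y, IsLargest CSR.InjLE (⟦γ⟧ : CSR Y) →
      ExtremallyConnected γ.space ∧
      (∃ h : γ.space ≃ₜ Dac (RC Y), ∀ y : Y, (h (γ.emb y)).1 = {F : RC Y | y ∈ F.1}) ∧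
      (∀ c : CSRExtension Y, ExtremallyConnected c.space →
        CSRExtension.Equivalent c γ)) := by
  have hY : Semiregular Y := semiregular_of_regularSpace
  have inj : ∀ a b : CSRExtension Y,
      CSR.InjLE (⟦a⟧ : CSR Y) ⟦b⟧ ↔ a.contact ≤ b.contact := fun _ _ => CSRExtension.injLE_iff
  have proj : ∀ a b : CSRExtension Y,
      CSR.ProjLE (⟦a⟧ : CSR Y) ⟦b⟧ ↔ b.contact ≤ a.contact := fun _ _ => CSRExtension.projLE_iff
  have eq : ∀ a b : CSRExtension Y, a.contact = b.contact → (⟦a⟧ : CSR Y) = ⟦b⟧ :=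
    fun _ _ h => Quotient.sound (CSRExtension.equivalent_of_contact_eq h)
  have hmin (a : CSRExtension Y) :
      (CSRExtension.ofContact hY (le_refl (standardContact Y))).contact ≤ a.contact :=
    (CSRExtension.contact_ofContact_le hY le_rfl).trans a.standardContact_le_contact
  have hmax (a : CSRExtension Y) : a.contact ≤
      (CSRExtension.ofContact hY (standardContact Y).le_largest).contact :=
    a.contact.le_largest.trans (CSRExtension.contact_ofContact_largest hY).ge
  refine ⟨{ refl := ?_, trans := ?_, antisymm := ?_ }, { refl := ?_, trans := ?_, antisymm := ?_ },
    ⟨⟦.ofContact hY le_rfl⟧, ⟦.ofContact hY (standardContact Y).le_largest⟧, ?_, ?_, ?_, ?_⟩,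
    fun γ hγ => ?_⟩
  · rintro ⟨a⟩
    exact (proj a a).2 le_rfl
  · rintro ⟨a⟩ ⟨b⟩ ⟨c⟩ h k
    exact (proj a c).2 (((proj b c).1 k).trans ((proj a b).1 h))
  · rintro ⟨a⟩ ⟨b⟩ h k
    exact eq a b (le_antisymm ((proj b a).1 k) ((proj a b).1 h))
  · rintro ⟨a⟩
    exact (inj a a).2 le_rfl
  · rintro ⟨a⟩ ⟨b⟩ ⟨c⟩ h k
    exact (inj a c).2 (((inj a b).1 h).trans ((inj b c).1 k))
  · rintro ⟨a⟩ ⟨b⟩ h k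
    exact eq a b (le_antisymm ((inj a b).1 h) ((inj b a).1 k))
  · rintro ⟨a⟩
    exact (inj _ a).2 (hmin a)
  · rintro ⟨a⟩
    exact (proj a _).2 (hmin a)
  · rintro ⟨a⟩
    exact (inj a _).2 (hmax a)
  · rintro ⟨a⟩
    exact (proj _ a).2 (hmax a)
  · have hl : γ.contact = ContactRel.largest (RC Y) :=
      le_antisymm γ.contact.le_largest
        ((CSRExtension.contact_ofContact_largest hY).ge.trans ((inj _ γ).1 (hγ _)))
    exact ⟨γ.extremallyConnected_iff.2 hl, γ.exists_homeomorph_of_contact_eq hl, fun c hc =>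
      CSRExtension.equivalent_of_contact_eq ((c.extremallyConnected_iff.1 hc).trans hl.symm)⟩
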